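/- Let $n\ge 1$, $\kappa\ge 0$ and $\rho>0$. Index vectors from $0$. Let $v=(1,\dots,1,0,\dots,0)\in\mathbb{R}^{2n}$ ($n$ ones followed by $n$ zeros), let $v^{\mathrm{DFT}}_k=\sum_{a=0}^{2n-1}v_a e^{-2\pi i ka/(2n)}$, let $F\in\mathbb{C}^{2n\times 2n}$ be the unitary DFT matrix, $F_{ka}=\frac{1}{\sqrt{2n}}e^{-2\pi i ka/(2n)}$, and let $\Sigma^{1/2}$ be the diagonal matrix of the principal square roots of the entries $v^{\mathrm{DFT}}_k$. Put $$\sigma^2=\frac{\kappa^2\,\|v^{\mathrm{DFT}}\|_1}{4n\rho}.$$ The FFT prefix-sum mechanism draws $w\in\mathbb{C}^{2n}$ whose coordinates are independent standard complex normals (independent real and imaginary parts, each distributed as $N(0,1)$), sets $z=\sigma F^*\Sigma^{1/2}w$, and, on a stream $x_0,\dots,x_{n-1}\in\mathbb{R}$, outputs at step $t$ the value $a_t=x_0+\dots+x_t+\operatorname{Re} z_t$. Adaptive continual release model with single participation: an adversary holds private random coins and, at each step $t$, chooses (measurably) two real numbers $g_t,h_t$ as functions of its coins and of the earlier answers $a_0,\dots,a_{t-1}$.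 It must guarantee that, whatever the coins and the answers are, the two streams $(g_t)_t$ and $(h_t)_t$ are neighboring: they differ in at most one step, and there by at most $\kappa$. Either all the $g_t$ or all the $h_t$ are fed to the mechanism. Let $P_g$ and $P_h$ be the laws of the adversary's view (its coins and all answers $a_0,\dots,a_{n-1}$) in these two games. Theorem. The FFT prefix-sum mechanism is $\rho$-zCDP in the adaptive continual release model under single participation: for every such adversary and every real $\alpha>1$, the Rényi divergences of order $\alpha$ satisfy $D_\alpha(P_g\,\|\,P_h)\le\rho\alpha$ and $D_\alpha(P_h\,\|\,P_g)\le\rho\alpha$. -/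

import Mathlib

open MeasureTheory ProbabilityTheory
open scoped ENNReal

universe u

/-- Rényi divergence of order `α > 1` between probability measures:
`D_α(P ‖ Q) = (α - 1)⁻¹ log ∫ (dP/dQ)^α dQ`, and `+∞` if `P` is not absolutely continuous
with respect to `Q`. -/
noncomputable def renyiDiv {X : Type*} [MeasurableSpace X] (α : ℝ) (P Q : Measure X) : EReal :=
  open Classical in
  if P ≪ Q then (((α - 1)⁻¹ : ℝ) : EReal) * ENNReal.log (∫⁻ x, (P.rnDeriv Q x) ^ α ∂Q) else ⊤

/-- A randomized mechanism on real streams of length `n` with one real output per step. The random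
seed is drawn once from `law`; the output at step `t` is a function of the entries `x_0, …, x_t`
received so far and of the seed. -/
structure StreamMechanism (n : ℕ) where
  Seed : Type
  measurableSpace : MeasurableSpace Seed
  law : Measure Seed
  isProb : IsProbabilityMeasure law
  out : (t : Fin n) → (Fin (t + 1) → ℝ) → Seed → ℝ
  measurable_out : ∀ t : Fin n, Measurable (fun p : (Fin (t + 1) → ℝ) × Seed => out t p.1 p.2)

attribute [instance] StreamMechanism.measurableSpace StreamMechanism.isProb

/-- The answers `a_0, …, a_{n-1}` of the mechanism run with the given seed, when the entry at
step `s` is `q s (a_0, …, a_{s-1})`. -/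
noncomputable def StreamMechanism.answer {n : ℕ} (M : StreamMechanism n)
    (q : (s : Fin n) → (Fin s → ℝ) → ℝ) (seed : M.Seed) (t : Fin n) : ℝ :=
  M.out t (fun s : Fin (t + 1) =>
    q ⟨s, by omega⟩ (fun r : Fin s => M.answer q seed ⟨r, by omega⟩)) seed
termination_by t.val
decreasing_by
  have h1 := r.isLt
  have _ := s.isLt
  show r.val < t.val
  omega

/-- A (randomized) adversary in the adaptive continual release model. It draws private coins and, at
each step `t`, chooses two entries `left` and `right` as functions of its coins and of the answers
`a_0, …, a_{t-1}` seen so far. -/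
structure StreamAdversary (n : ℕ) where
  Coins : Type u
  measurableSpace : MeasurableSpace Coins
  law : Measure Coins
  isProb : IsProbabilityMeasure law
  left : (t : Fin n) → Coins → (Fin t → ℝ) → ℝ
  right : (t : Fin n) → Coins → (Fin t → ℝ) → ℝ
  measurable_left : ∀ t : Fin n, Measurable (fun p : Coins × (Fin t → ℝ) => left t p.1 p.2)
  measurable_right : ∀ t : Fin n, Measurable (fun p : Coins × (Fin t → ℝ) => right t p.1 p.2)

attribute [instance] StreamAdversary.measurableSpace StreamAdversary.isProb

/-- The adversary keeps its promise: whatever its coins and the answers are, the two streams that it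
produces are neighboring. -/
def StreamAdversary.Valid {n : ℕ} (N : (Fin n → ℝ) → (Fin n → ℝ) → Prop)
    (A : StreamAdversary.{u} n) : Prop :=
  ∀ (c : A.Coins) (a : Fin n → ℝ),
    N (fun t => A.left t c (fun s => a ⟨s, s.isLt.trans t.isLt⟩))
      (fun t => A.right t c (fun s => a ⟨s, s.isLt.trans t.isLt⟩))

/-- The law of the adversary's view (its coins and all answers of the mechanism) in the game where
the entries given by `q` are fed to the mechanism. -/
noncomputable def StreamAdversary.view {n : ℕ} (A : StreamAdversary.{u} n) (M : StreamMechanism n)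
    (q : (t : Fin n) → A.Coins → (Fin t → ℝ) → ℝ) : Measure (A.Coins × (Fin n → ℝ)) :=
  (A.law.prod M.law).map (fun p => (p.1, M.answer (fun t => q t p.1) p.2))

/-- The answers are jointly measurable in coins and seed, so that the law of the view is a genuine
push-forward. -/
theorem StreamAdversary.measurable_view {n : ℕ} (A : StreamAdversary.{u} n) (M : StreamMechanism n)
    (q : (t : Fin n) → A.Coins → (Fin t → ℝ) → ℝ)
    (hq : ∀ t : Fin n, Measurable (fun p : A.Coins × (Fin t → ℝ) => q t p.1 p.2)) :
    Measurable (fun p : A.Coins × M.Seed => (p.1, M.answer (fun t => q t p.1) p.2)) := by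
  have key : ∀ (m : ℕ) (hm : m < n),
      Measurable (fun p : A.Coins × M.Seed => M.answer (fun t => q t p.1) p.2 ⟨m, hm⟩) := by
    intro m
    induction m using Nat.strong_induction_on with
    | _ m ih =>
      intro hm
      have h : (fun p : A.Coins × M.Seed => M.answer (fun t => q t p.1) p.2 ⟨m, hm⟩) =
          fun p => M.out ⟨m, hm⟩ (fun s : Fin (m + 1) =>
            q ⟨s, by omega⟩ p.1 (fun r : Fin s =>
              M.answer (fun t => q t p.1) p.2 ⟨r, by omega⟩)) p.2 := by
        funext p
        rw [StreamMechanism.answer]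
      rw [h]
      refine (M.measurable_out ⟨m, hm⟩).comp (Measurable.prodMk ?_ measurable_snd)
      refine measurable_pi_lambda _ fun s => ?_
      refine (hq ⟨s, by omega⟩).comp (Measurable.prodMk measurable_fst ?_)
      exact measurable_pi_lambda _ fun r => ih r (by have := r.isLt; have := s.isLt; omega) _
  exact Measurable.prodMk measurable_fst (measurable_pi_lambda _ fun t => key t t.isLt)

/-- `ρ`-zCDP in the adaptive continual release model, for the neighboring relation `N`: for each
adversary whose two streams are always neighboring, the Rényi divergences of every order `α > 1`
between its views in the `left` and in the `right` game are at most `ρ α`. -/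
def StreamMechanism.IsAdaptiveZCDP {n : ℕ} (M : StreamMechanism n)
    (N : (Fin n → ℝ) → (Fin n → ℝ) → Prop) (ρ : ℝ) : Prop :=
  ∀ A : StreamAdversary.{u} n, A.Valid N → ∀ α : ℝ, 1 < α →
    renyiDiv α (A.view M A.left) (A.view M A.right) ≤ ((ρ * α : ℝ) : EReal) ∧
    renyiDiv α (A.view M A.right) (A.view M A.left) ≤ ((ρ * α : ℝ) : EReal)

/-- Single participation: neighboring streams differ in the entry of a single step, by at
most `κ`. -/
def SingleParticipation (n : ℕ) (κ : ℝ) (x y : Fin n → ℝ) : Prop :=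
  ∃ i, (∀ j, j ≠ i → x j = y j) ∧ |x i - y i| ≤ κ

/-- `v = (1, …, 1, 0, …, 0)` with `n` ones and `n` zeros: the first column of the circulant
extension of the prefix-sum matrix. -/
def fftV (n : ℕ) (a : Fin (2 * n)) : ℂ := if (a : ℕ) < n then 1 else 0

/-- The (unnormalized) discrete Fourier transform of `v`. -/
noncomputable def fftVDFT (n : ℕ) (k : Fin (2 * n)) : ℂ :=
  ∑ a : Fin (2 * n), fftV n a *
    Complex.exp (-(Complex.I * 2 * Real.pi * (k : ℕ) * (a : ℕ)) / (2 * n))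

/-- The (unitary) DFT matrix in dimension `2n`. -/
noncomputable def fftMatrix (n : ℕ) : Matrix (Fin (2 * n)) (Fin (2 * n)) ℂ :=
  Matrix.of fun k a => ((1 / Real.sqrt (2 * n) : ℝ) : ℂ) *
    Complex.exp (-(Complex.I * 2 * Real.pi * (k : ℕ) * (a : ℕ)) / (2 * n))

/-- The entrywise principal square root `Σ^{1/2}` of `Σ = diag(v^DFT)`. -/
noncomputable def fftSqrtSigma (n : ℕ) : Matrix (Fin (2 * n)) (Fin (2 * n)) ℂ :=
  Matrix.diagonal fun k => (fftVDFT n k) ^ (1 / 2 : ℂ)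

/-- The noise scale `σ = √(κ² ‖v^DFT‖₁ / (4 n ρ))`. -/
noncomputable def fftSigma (n : ℕ) (κ ρ : ℝ) : ℝ :=
  Real.sqrt (κ ^ 2 * (∑ k, ‖fftVDFT n k‖) / (4 * n * ρ))

/-- The noise vector `z = σ F^* Σ^{1/2} w`. -/
noncomputable def fftNoise (n : ℕ) (κ ρ : ℝ) (w : Fin (2 * n) → ℂ) : Fin (2 * n) → ℂ :=
  (fftSigma n κ ρ : ℂ) •
    ((fftMatrix n).conjTranspose.mulVec ((fftSqrtSigma n).mulVec w))

/-- The standard complex normal: independent real and imaginary parts, each `N(0, 1)`. -/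
noncomputable def stdComplexNormal : Measure ℂ :=
  ((gaussianReal 0 1).prod (gaussianReal 0 1)).map Complex.measurableEquivRealProd.symm

instance : IsProbabilityMeasure stdComplexNormal :=
  Measure.isProbabilityMeasure_map Complex.measurableEquivRealProd.symm.measurable.aemeasurable

/-- The FFT prefix-sum mechanism: with `w` a standard complex normal vector in dimension `2n`, the
output at step `t` is `x_0 + … + x_t + Re z_t`. -/
noncomputable def fftMechanism (n : ℕ) (κ ρ : ℝ) : StreamMechanism n where
  Seed := Fin (2 * n) → ℂ
  measurableSpace := inferInstance
  law := Measure.pi fun _ => stdComplexNormal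
  isProb := inferInstance
  out t x w := (∑ s, x s) + (fftNoise n κ ρ w ⟨t, by omega⟩).re
  measurable_out t := by
    simp only [fftNoise, Matrix.mulVec, dotProduct, Pi.smul_apply, smul_eq_mul]
    fun_prop

/-! In `ℂ^{2n}`, viewed as a real Euclidean space, `Re z_t` is the inner product of `w` with a fixed
vector `l_t`. Since the circulant matrix `F^* Σ F` extends the prefix-sum matrix, there are vectors
`μ_i` with `⟪l_t, μ_i⟫ = 1` for `i ≤ t` and `0` otherwise: moving `w` by `μ_i` changes the answers
exactly as raising `x_i` by one does. For fixed streams this compares a Gaussian with its translate.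

An adaptive adversary makes the translation depend on the noise itself. Gram-Schmidt applied to the
`l_t` (`exists_causal_coordinates`) gives coordinates of `w` in which `a_t` involves only
coordinates up to `t`, while the shift for step `i` starts at coordinate `i`. The random shift is
then causal: each coordinate of it is a function of earlier coordinates. Girsanov's formula
(`lintegral_causal_shift`) turns one game into the other at the price of an explicit density. Its
moment of order `α` is controlled by the squared length of the shift, at most `κ² ‖μ_i‖² = κ²
‖v^DFT‖₁ / (2nσ²) = 2ρ` when `κ > 0`. Data processing (`lintegral_rnDeriv_rpow_le`) carries the
bound from seeds to views. -/

/-! ### Causal shifts of Gaussian vectors. -/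

theorem lintegral_gaussianReal_shift (m : ℝ) {F : ℝ → ℝ≥0∞} (hF : Measurable F) :
    ∫⁻ y, F (y - m) * ENNReal.ofReal (Real.exp (m * y - m ^ 2 / 2)) ∂gaussianReal 0 1 =
      ∫⁻ y, F y ∂gaussianReal 0 1 := by
  rw [gaussianReal_of_var_ne_zero 0 one_ne_zero,
    lintegral_withDensity_eq_lintegral_mul _ (measurable_gaussianPDF 0 1) (by fun_prop),
    lintegral_withDensity_eq_lintegral_mul _ (measurable_gaussianPDF 0 1) hF]
  conv_rhs => rw [← lintegral_sub_right_eq_self _ m]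
  refine lintegral_congr fun y => ?_
  simp only [Pi.mul_apply, gaussianPDF]
  rw [mul_comm (F _), ← mul_assoc, ← ENNReal.ofReal_mul (gaussianPDFReal_nonneg _ _ _)]
  congr 2
  simp only [gaussianPDFReal]
  rw [mul_assoc, ← Real.exp_add]
  congr 2
  simp only [NNReal.coe_one]
  ring

/-- Girsanov's formula in finite dimension: a causal shift of a standard Gaussian vector. -/
theorem lintegral_causal_shift {N : ℕ} (m : Fin N → (Fin N → ℝ) → ℝ)
    (hm : ∀ s, Measurable (m s))
    (hc : ∀ s y y', (∀ r, r < s → y r = y' r) → m s y = m s y')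
    {F : (Fin N → ℝ) → ℝ≥0∞} (hF : Measurable F) :
    ∫⁻ y, F (fun s => y s - m s y) *
        ENNReal.ofReal (Real.exp (∑ s, (m s y * y s - m s y ^ 2 / 2)))
        ∂(Measure.pi fun _ => gaussianReal 0 1) =
      ∫⁻ y, F y ∂Measure.pi fun _ => gaussianReal 0 1 := by
  induction N with
  | zero =>
    refine lintegral_congr fun y => ?_
    rw [Subsingleton.elim (fun s => y s - m s y) y]
    simp
  | succ N ih =>
    have hsnoc : Measurable fun p : ℝ × (Fin N → ℝ) => (Fin.snoc p.2 p.1 : Fin (N + 1) → ℝ) := by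
      refine measurable_pi_lambda _ fun s => ?_
      refine Fin.lastCases ?_ (fun i => ?_) s
      · simpa using measurable_fst
      · simpa using! (measurable_pi_apply i).comp measurable_snd
    have key : ∀ G : (Fin (N + 1) → ℝ) → ℝ≥0∞, Measurable G →
        ∫⁻ y, G y ∂(Measure.pi fun _ => gaussianReal 0 1) =
        ∫⁻ y' : Fin N → ℝ, ∫⁻ x, G (Fin.snoc y' x) ∂gaussianReal 0 1
          ∂(Measure.pi fun _ => gaussianReal 0 1) := by
      intro G hG
      have hp := (measurePreserving_piFinSuccAbove (α := fun _ : Fin (N + 1) => ℝ)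
        (fun _ => gaussianReal 0 1) (Fin.last N)).symm
      rw [← hp.lintegral_comp hG, lintegral_prod_symm]
      · refine lintegral_congr fun y' => lintegral_congr fun x => ?_
        simp [MeasurableEquiv.piFinSuccAbove, Fin.insertNthEquiv]
      · exact (hG.comp (MeasurableEquiv.measurable _)).aemeasurable
    have hlast : ∀ (y' : Fin N → ℝ) x, m (Fin.last N) (Fin.snoc y' x) =
        m (Fin.last N) (Fin.snoc y' 0) := by
      intro y' x
      refine hc _ _ _ fun r hr => ?_
      obtain ⟨r, rfl⟩ := Fin.exists_castSucc_eq.2 hr.ne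
      simp
    have hcast : ∀ (s : Fin N) (y' : Fin N → ℝ) x, m s.castSucc (Fin.snoc y' x) =
        m s.castSucc (Fin.snoc y' 0) := by
      intro s y' x
      refine hc _ _ _ fun r hr => ?_
      obtain ⟨r, rfl⟩ := Fin.exists_castSucc_eq.2 (hr.trans s.castSucc_lt_last).ne
      simp
    have hsnoc0 : Measurable fun y' : Fin N → ℝ => (Fin.snoc y' 0 : Fin (N + 1) → ℝ) :=
      hsnoc.comp (measurable_const.prodMk measurable_id)
    have hFs : Measurable fun y' : Fin N → ℝ => ∫⁻ x, F (Fin.snoc y' x) ∂gaussianReal 0 1 :=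
      Measurable.lintegral_prod_left' (f := fun p : ℝ × (Fin N → ℝ) => F (Fin.snoc p.2 p.1))
        (hF.comp hsnoc)
    rw [key _ (by fun_prop), key _ hF,
      ← ih (fun s y' => m s.castSucc (Fin.snoc y' 0)) (fun s => (hm _).comp hsnoc0)
        (fun s y y' h => hc _ _ _ fun r hr => ?_) hFs]
    · refine lintegral_congr fun y' => ?_
      have hx : Measurable fun x : ℝ => (Fin.snoc (fun s : Fin N =>
          y' s - m s.castSucc (Fin.snoc y' 0)) x : Fin (N + 1) → ℝ) :=
        hsnoc.comp (measurable_id.prodMk (measurable_const (a := fun s : Fin N =>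
          y' s - m s.castSucc (Fin.snoc y' 0))))
      have hshift := lintegral_gaussianReal_shift (m (Fin.last N) (Fin.snoc y' 0)) (hF.comp hx)
      simp only [Function.comp_apply] at hshift
      rw [← hshift,
        ← lintegral_mul_const _ (by fun_prop)]
      refine lintegral_congr fun x => ?_
      rw [mul_assoc, ← ENNReal.ofReal_mul (Real.exp_nonneg _), ← Real.exp_add,
        Fin.sum_univ_castSucc]
      simp only [hlast y' x, hcast _ y' x, Fin.snoc_castSucc, Fin.snoc_last]
      congr 1
      · congr 1
        funext s
        refine Fin.lastCases ?_ (fun i => ?_) s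
        · simp [hlast y' x]
        · simp [hcast _ y' x]
      · rw [add_comm]
    · obtain ⟨r, rfl⟩ := Fin.exists_castSucc_eq.2 (hr.trans s.castSucc_lt_last).ne
      simpa using h r (by simpa using hr)

/-- The exponential moments of the Girsanov density of a bounded causal shift. -/
theorem lintegral_girsanov_rpow_le {N : ℕ} (m : Fin N → (Fin N → ℝ) → ℝ)
    (hm : ∀ s, Measurable (m s))
    (hc : ∀ s y y', (∀ r, r < s → y r = y' r) → m s y = m s y') {B α : ℝ}
    (hB : ∀ y, ∑ s, m s y ^ 2 ≤ 2 * B) (hα : 1 < α) :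
    ∫⁻ y, ENNReal.ofReal (Real.exp (∑ s, (m s y * y s - m s y ^ 2 / 2))) ^ α
        ∂(Measure.pi fun _ => gaussianReal 0 1) ≤ ENNReal.ofReal (Real.exp (α * (α - 1) * B)) := by
  -- The density for the shift `α m` has integral one. The `α`-th power of the density for `m` is
  -- that density times `exp (α (α - 1) / 2 * ∑ m²)`.
  have h1 := lintegral_causal_shift (fun s y => α * m s y) (fun s => (hm s).const_mul α)
    (fun s y y' h => by simp only [hc s y y' h]) (F := fun _ => 1) measurable_const
  simp only [one_mul, lintegral_const, measure_univ] at h1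
  calc _ ≤ ∫⁻ y, ENNReal.ofReal (Real.exp (α * (α - 1) * B)) * ENNReal.ofReal
          (Real.exp (∑ s, (α * m s y * y s - (α * m s y) ^ 2 / 2)))
        ∂Measure.pi fun _ => gaussianReal 0 1 := by
        refine lintegral_mono fun y => ?_
        rw [ENNReal.ofReal_rpow_of_pos (Real.exp_pos _), ← Real.exp_mul,
          ← ENNReal.ofReal_mul (Real.exp_nonneg _), ← Real.exp_add]
        refine ENNReal.ofReal_le_ofReal (Real.exp_le_exp.2 ?_)
        have e1 : ∑ s, (m s y * y s - m s y ^ 2 / 2) =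
            ∑ s, m s y * y s - (∑ s, m s y ^ 2) / 2 := by
          rw [Finset.sum_sub_distrib, Finset.sum_div]
        have e2 : ∑ s, (α * m s y * y s - (α * m s y) ^ 2 / 2) =
            α * ∑ s, m s y * y s - α ^ 2 * (∑ s, m s y ^ 2) / 2 := by
          rw [Finset.sum_sub_distrib, Finset.mul_sum, Finset.mul_sum, Finset.sum_div]
          simp only [mul_pow, mul_assoc]
        rw [e1, e2]
        nlinarith [mul_le_mul_of_nonneg_left (hB y)
          (mul_nonneg (by linarith : (0 : ℝ) ≤ α) (by linarith : (0 : ℝ) ≤ α - 1))]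
    _ = _ := by
        rw [lintegral_const_mul _ (by fun_prop), h1, mul_one]

/-! ### Rényi divergence and data processing. -/

/-- Data processing for the Hellinger integral of order `α`. -/
theorem lintegral_rnDeriv_rpow_le {X Y : Type*} [MeasurableSpace X] [MeasurableSpace Y]
    {ν : Measure X} {P Q : Measure Y} [IsFiniteMeasure P] [IsFiniteMeasure Q] {f : X → Y}
    (hf : Measurable f) {Z : X → ℝ≥0∞} (hZ : Measurable Z) (hQ : Q = ν.map f)
    (hP : P = (ν.withDensity Z).map f) {α : ℝ} (hα : 1 < α) :
    P ≪ Q ∧ ∫⁻ y, P.rnDeriv Q y ^ α ∂Q ≤ ∫⁻ x, Z x ^ α ∂ν := by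
  have hac : P ≪ Q := by
    rw [hP, hQ]
    exact (withDensity_absolutelyContinuous ν Z).map hf
  refine ⟨hac, ?_⟩
  have hα0 : 0 < α := by linarith
  have hα1 : 0 < α - 1 := by linarith
  set g := P.rnDeriv Q with hg
  have hgm : Measurable g := Measure.measurable_rnDeriv P Q
  have hpq : (α / (α - 1)).HolderConjugate α := (Real.HolderConjugate.conjExponent hα).symm
  -- Truncation makes the integral `I` finite, so that a power of it can be cancelled. Bound `I` by
  -- the integral of `min g K ^ (α - 1)` against `P`, pull it back to `ν`, and apply Hölder: the
  -- first factor is again a power of `I`.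
  have htrunc : ∀ K : ℕ, ∫⁻ y, min (g y) K ^ α ∂Q ≤ ∫⁻ x, Z x ^ α ∂ν := by
    intro K
    set I := ∫⁻ y, min (g y) K ^ α ∂Q with hI
    have hmm : Measurable fun y => min (g y) (K : ℝ≥0∞) := hgm.min measurable_const
    have hItop : I ≠ ⊤ := by
      refine ((lintegral_mono fun y => ENNReal.rpow_le_rpow (min_le_right _ _) hα0.le).trans_lt
        (?_ : ∫⁻ _, (K : ℝ≥0∞) ^ α ∂Q < ⊤)).ne
      rw [lintegral_const]
      exact ENNReal.mul_lt_top (ENNReal.rpow_lt_top_of_nonneg hα0.le (by simp))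
        (measure_lt_top _ _)
    have h1 : I ≤ ∫⁻ y, g y * min (g y) K ^ (α - 1) ∂Q := by
      refine lintegral_mono fun y => ?_
      rw [show α = 1 + (α - 1) by ring, ENNReal.rpow_add_of_nonneg _ _ zero_le_one hα1.le,
        ENNReal.rpow_one, add_sub_cancel_left]
      gcongr
      exact min_le_left _ _
    have h2 : ∫⁻ y, g y * min (g y) K ^ (α - 1) ∂Q =
        ∫⁻ x, ((fun x => min (g (f x)) (K : ℝ≥0∞) ^ (α - 1)) * Z) x ∂ν := by
      rw [lintegral_rnDeriv_mul hac (by fun_prop), hP, lintegral_map (by fun_prop) hf,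
        lintegral_withDensity_eq_lintegral_mul _ hZ (by fun_prop)]
      refine lintegral_congr fun x => ?_
      simp only [Pi.mul_apply, mul_comm]
    have h3 := ENNReal.lintegral_mul_le_Lp_mul_Lq ν hpq
      (f := fun x => min (g (f x)) (K : ℝ≥0∞) ^ (α - 1)) (g := Z)
      (by fun_prop) hZ.aemeasurable
    have h4 : ∫⁻ x, (min (g (f x)) (K : ℝ≥0∞) ^ (α - 1)) ^ (α / (α - 1)) ∂ν = I := by
      rw [hI, hQ, lintegral_map (by fun_prop) hf]
      refine lintegral_congr fun x => ?_
      rw [← ENNReal.rpow_mul, mul_div_cancel₀ _ hα1.ne']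
    rw [h4] at h3
    have h5 : I ≤ I ^ (1 / (α / (α - 1))) * (∫⁻ x, Z x ^ α ∂ν) ^ (1 / α) :=
      h1.trans (h2.le.trans h3)
    rcases eq_or_ne I 0 with h0 | h0
    · simp [h0]
    have h6 : I = I ^ (1 / (α / (α - 1))) * I ^ (1 / α) := by
      rw [← ENNReal.rpow_add _ _ h0 hItop]
      have : 1 / (α / (α - 1)) + 1 / α = 1 := by field_simp; ring
      rw [this, ENNReal.rpow_one]
    have h7 : I ^ (1 / α) ≤ (∫⁻ x, Z x ^ α ∂ν) ^ (1 / α) := by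
      have ha : I ^ (1 / (α / (α - 1))) ≠ 0 := by simp [h0, hItop]
      have hb : I ^ (1 / (α / (α - 1))) ≠ ⊤ :=
        ENNReal.rpow_ne_top_of_nonneg (by positivity) hItop
      refine (ENNReal.mul_le_mul_iff_right ha hb).1 ?_
      rwa [← h6]
    exact (ENNReal.rpow_le_rpow_iff (by positivity)).1 h7
  have hlim : ∀ y, Filter.Tendsto (fun K : ℕ => min (g y) (K : ℝ≥0∞) ^ α) Filter.atTop
      (nhds (g y ^ α)) := by
    intro y
    refine (ENNReal.continuous_rpow_const.tendsto _).comp ?_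
    simpa using (tendsto_const_nhds (x := g y)).min ENNReal.tendsto_nat_nhds_top
  refine le_of_tendsto' (lintegral_tendsto_of_tendsto_of_monotone
    (f := fun (K : ℕ) y => min (g y) (K : ℝ≥0∞) ^ α) (fun K => by fun_prop)
    (Filter.Eventually.of_forall fun y K K' h => ?_) (Filter.Eventually.of_forall hlim)) htrunc
  refine ENNReal.rpow_le_rpow (min_le_min_left _ ?_) hα0.le
  exact_mod_cast h

theorem renyiDiv_le_of_lintegral_le {X : Type*} [MeasurableSpace X] {P Q : Measure X} {α B : ℝ}
    (hα : 1 < α) (hac : P ≪ Q)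
    (h : ∫⁻ x, P.rnDeriv Q x ^ α ∂Q ≤ ENNReal.ofReal (Real.exp (α * (α - 1) * B))) :
    renyiDiv α P Q ≤ ((B * α : ℝ) : EReal) := by
  have hα1 : 0 < α - 1 := by linarith
  rw [renyiDiv, if_pos hac]
  calc _ ≤ (((α - 1)⁻¹ : ℝ) : EReal) *
        ENNReal.log (ENNReal.ofReal (Real.exp (α * (α - 1) * B))) := by
        refine mul_le_mul_of_nonneg_left (ENNReal.log_monotone h) ?_
        exact_mod_cast (inv_pos.2 hα1).le
    _ = _ := by
        rw [ENNReal.log_ofReal_of_pos (Real.exp_pos _), Real.log_exp, ← EReal.coe_mul]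
        congr 1
        field_simp

/-! ### Complex normal vectors as real standard Gaussians. -/

theorem stdComplexNormal_eq_stdGaussian : stdComplexNormal = stdGaussian ℂ := by
  rw [stdGaussian_eq_map_pi_orthonormalBasis Complex.orthonormalBasisOneI, stdComplexNormal,
    ← (measurePreserving_finTwoArrow (gaussianReal 0 1)).map_eq, Measure.map_map
      (MeasurableEquiv.measurable _) (MeasurableEquiv.measurable _)]
  congr 1
  funext x
  apply Complex.ext <;> simp [MeasurableEquiv.finTwoArrow, Complex.measurableEquivRealProd]

/-- The two characteristic functions agree because the squared norm is the sum of those of the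
coordinates. This gives access to the rotation invariance of `stdGaussian`. -/
theorem map_pi_stdComplexNormal (n : ℕ) :
    (Measure.pi fun _ : Fin n => stdComplexNormal).map (WithLp.toLp 2) =
      stdGaussian (PiLp 2 fun _ : Fin n => ℂ) := by
  apply Measure.ext_of_charFun (E := PiLp 2 fun _ : Fin n => ℂ)
  ext t
  simp_rw [stdComplexNormal_eq_stdGaussian, charFun_stdGaussian, charFun_pi, charFun_stdGaussian,
    ← Complex.exp_sum]
  congr 1
  rw [← Finset.sum_div, Finset.sum_neg_distrib]
  norm_cast
  rw [PiLp.norm_sq_eq_of_L2]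

/-! ### Change of seed. -/

theorem StreamMechanism.answer_congr_seed {n : ℕ} {M M' : StreamMechanism n}
    {ψ : M'.Seed → M.Seed} (hout : ∀ t x s, M.out t x (ψ s) = M'.out t x s)
    (q : (s : Fin n) → (Fin s → ℝ) → ℝ) (seed : M'.Seed) :
    M.answer q (ψ seed) = M'.answer q seed := by
  funext t
  induction t using WellFoundedLT.induction with
  | ind t ih =>
    rw [StreamMechanism.answer, StreamMechanism.answer, hout]
    congr 1
    funext s
    congr 1
    funext r
    exact ih _ (Fin.lt_def.2 (by have := r.isLt; have := s.isLt; simp only at *; omega))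

/-- The law of the view is unchanged when the seed is sampled through another seed. -/
theorem StreamAdversary.view_congr_seed {n : ℕ} (A : StreamAdversary.{u} n)
    {M M' : StreamMechanism n} {ψ : M'.Seed → M.Seed} (hψ : Measurable ψ)
    (hlaw : M.law = M'.law.map ψ) (hout : ∀ t x s, M.out t x (ψ s) = M'.out t x s)
    {q : (t : Fin n) → A.Coins → (Fin t → ℝ) → ℝ}
    (hq : ∀ t : Fin n, Measurable (fun p : A.Coins × (Fin t → ℝ) => q t p.1 p.2)) :
    A.view M q = A.view M' q := by
  have h : A.law.prod M.law = (A.law.prod M'.law).map (Prod.map id ψ) := by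
    rw [hlaw, ← Measure.map_prod_map _ _ measurable_id hψ, Measure.map_id]
  rw [StreamAdversary.view, h, Measure.map_map (A.measurable_view M q hq)
    (measurable_id.prodMap hψ), StreamAdversary.view]
  congr 1
  funext p
  simp [StreamMechanism.answer_congr_seed hout]

/-! ### Prefix sums with triangular Gaussian noise. -/

/-- The mechanism that releases prefix sums with the noise `L y`, for a standard Gaussian
vector `y`. -/
noncomputable def prefixSumMechanism {n N : ℕ} (L : Fin n → Fin N → ℝ) : StreamMechanism n where
  Seed := Fin N → ℝ
  measurableSpace := inferInstance
  law := Measure.pi fun _ => gaussianReal 0 1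
  isProb := inferInstance
  out t x y := (∑ s, x s) + ∑ s, L t s * y s
  measurable_out t := by fun_prop

/-- The answers of `prefixSumMechanism L` for the Gaussian vector `y`. -/
noncomputable def prefixSumAnswer {n N : ℕ} (L : Fin n → Fin N → ℝ)
    (q : (s : Fin n) → (Fin s → ℝ) → ℝ) (y : Fin N → ℝ) : Fin n → ℝ :=
  (prefixSumMechanism L).answer q y

/-- The initial segment of `a` of length `t`. -/
def initialSegment {n : ℕ} (a : Fin n → ℝ) (t : Fin n) : Fin t → ℝ :=
  fun s => a ⟨s, s.isLt.trans t.isLt⟩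

theorem measurable_initialSegment {n : ℕ} (t : Fin n) :
    Measurable fun a : Fin n → ℝ => initialSegment a t :=
  measurable_pi_lambda _ fun _ => measurable_pi_apply _

theorem initialSegment_congr {n : ℕ} {a a' : Fin n → ℝ} {t : Fin n} (h : ∀ s < t, a s = a' s) :
    initialSegment a t = initialSegment a' t :=
  funext fun s => h _ (Fin.lt_def.2 s.isLt)

theorem Fin.sum_univ_eq_sum_Iic {n : ℕ} (t : Fin n) (f : Fin n → ℝ) :
    ∑ s : Fin (t + 1), f ⟨s, by omega⟩ = ∑ i ∈ Finset.Iic t, f i := by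
  refine Finset.sum_bij (fun s _ => ⟨s, by omega⟩) ?_ ?_ ?_ ?_
  · intro s _
    simp only [Finset.mem_Iic, Fin.le_def]
    omega
  · intro s _ s' _ h
    simpa [Fin.ext_iff] using h
  · intro i hi
    have := Fin.le_def.1 (Finset.mem_Iic.1 hi)
    exact ⟨⟨i, by omega⟩, Finset.mem_univ _, rfl⟩
  · intro s _
    rfl

section PrefixSum

variable {n N : ℕ} {L : Fin n → Fin N → ℝ}

theorem prefixSumAnswer_apply (q : (s : Fin n) → (Fin s → ℝ) → ℝ) (y : Fin N → ℝ)
    (t : Fin n) :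
    prefixSumAnswer L q y t =
      ∑ i ∈ Finset.Iic t, q i (initialSegment (prefixSumAnswer L q y) i) +
        ∑ s, L t s * y s := by
  rw [← Fin.sum_univ_eq_sum_Iic t fun i => q i (initialSegment (prefixSumAnswer L q y) i)]
  unfold prefixSumAnswer
  exact StreamMechanism.answer.eq_1 _ _ _ _

theorem prefixSumAnswer_congr (hL : ∀ (t : Fin n) (s : Fin N), t.val < s.val → L t s = 0)
    (q : (s : Fin n) → (Fin s → ℝ) → ℝ) {y y' : Fin N → ℝ} (t : Fin n)
    (h : ∀ s : Fin N, s.val ≤ t.val → y s = y' s) :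
    prefixSumAnswer L q y t = prefixSumAnswer L q y' t := by
  induction t using WellFoundedLT.induction with
  | ind t ih =>
    rw [prefixSumAnswer_apply, prefixSumAnswer_apply]
    congr 1
    · refine Finset.sum_congr rfl fun i hi => ?_
      rw [initialSegment_congr fun r hr => ?_]
      have hrt : r < t := hr.trans_le (Finset.mem_Iic.1 hi)
      exact ih r hrt fun s hs => h s (hs.trans (Fin.le_def.1 hrt.le))
    · refine Finset.sum_congr rfl fun s _ => ?_
      rcases le_or_gt s.val t.val with hs | hs
      · rw [h s hs]
      · rw [hL t s hs, zero_mul, zero_mul]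

/-- The shift of the Gaussian seed that compensates for feeding `q'` instead of `q` to the
mechanism. -/
noncomputable def compensatingShift (L U : Fin n → Fin N → ℝ)
    (q q' : (s : Fin n) → (Fin s → ℝ) → ℝ) (s : Fin N) (y : Fin N → ℝ) : ℝ :=
  ∑ i, (q i (initialSegment (prefixSumAnswer L q' y) i) -
    q' i (initialSegment (prefixSumAnswer L q' y) i)) * U i s

variable {U : Fin n → Fin N → ℝ} (q q' : (s : Fin n) → (Fin s → ℝ) → ℝ)

/-- Only steps `i ≤ s` contribute to coordinate `s`, and the entries at step `i` depend on answers
before `i`, hence on seed coordinates before `i`. This is the causality required by Girsanov's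
formula. -/
theorem compensatingShift_congr (hL : ∀ (t : Fin n) (s : Fin N), t.val < s.val → L t s = 0)
    (hU : ∀ (i : Fin n) (s : Fin N), s.val < i.val → U i s = 0) (s : Fin N) (y y' : Fin N → ℝ)
    (h : ∀ r, r < s → y r = y' r) :
    compensatingShift L U q q' s y = compensatingShift L U q q' s y' := by
  refine Finset.sum_congr rfl fun i _ => ?_
  rcases lt_or_ge s.val i.val with hs | hs
  · rw [hU i s hs, mul_zero, mul_zero]
  · rw [initialSegment_congr (a := prefixSumAnswer L q' y) fun r hr =>
      prefixSumAnswer_congr hL q' r fun s' hs' => h s' ?_]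
    have := Fin.lt_def.1 hr
    exact Fin.lt_def.2 (by omega)

/-- Induction on time: if the earlier answers agree, both games query the same transcript, and the
shift changes the noise at step `t` by the accumulated difference of the entries, which cancels. -/
theorem prefixSumAnswer_shift
    (hL : ∀ (t : Fin n) (s : Fin N), t.val < s.val → L t s = 0)
    (hU : ∀ (i : Fin n) (s : Fin N), s.val < i.val → U i s = 0)
    (hLU : ∀ t i : Fin n, i ≤ t → ∑ s, L t s * U i s = 1) (y : Fin N → ℝ) :
    prefixSumAnswer L q (fun s => y s - compensatingShift L U q q' s y) =
      prefixSumAnswer L q' y := by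
  -- For `i > t` the supports of `L t` and `U i` are disjoint, so triangularity supplies the zero
  -- half of the prefix-sum matrix.
  have hLU' : ∀ t i : Fin n, ∑ s, L t s * U i s = if i ∈ Finset.Iic t then 1 else 0 := by
    intro t i
    split_ifs with h
    · exact hLU t i (Finset.mem_Iic.1 h)
    · have h' := Fin.lt_def.1 (not_le.1 fun h' => h (Finset.mem_Iic.2 h'))
      refine Finset.sum_eq_zero fun s _ => ?_
      rcases lt_or_ge s.val i.val with hs | hs
      · rw [hU i s hs, mul_zero]
      · rw [hL t s (h'.trans_le hs), zero_mul]
  funext t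
  induction t using WellFoundedLT.induction with
  | ind t ih =>
    have hseg : ∀ i ∈ Finset.Iic t, initialSegment (prefixSumAnswer L q
          (fun s => y s - compensatingShift L U q q' s y)) i =
        initialSegment (prefixSumAnswer L q' y) i := fun i hi =>
      initialSegment_congr fun r hr => ih r (hr.trans_le (Finset.mem_Iic.1 hi))
    rw [prefixSumAnswer_apply, prefixSumAnswer_apply,
      Finset.sum_congr rfl fun i hi => congrArg (q i) (hseg i hi)]
    set a := prefixSumAnswer L q' y with ha
    have hsum : ∑ s, L t s * compensatingShift L U q q' s y =
        ∑ i ∈ Finset.Iic t, (q i (initialSegment a i) - q' i (initialSegment a i)) := by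
      simp only [compensatingShift, Finset.mul_sum, ← ha]
      rw [Finset.sum_comm]
      calc _ = ∑ i, (q i (initialSegment a i) - q' i (initialSegment a i)) *
            ∑ s, L t s * U i s := by
            refine Finset.sum_congr rfl fun i _ => ?_
            rw [Finset.mul_sum]
            exact Finset.sum_congr rfl fun s _ => by ring
        _ = _ := by
            simp only [hLU', mul_ite, mul_one, mul_zero, Finset.sum_ite_mem, Finset.univ_inter]
    simp only [mul_sub, Finset.sum_sub_distrib]
    rw [hsum, Finset.sum_sub_distrib]
    ring

/-- On each transcript a single step contributes, so the shift is a multiple of one row of `U`.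
Which step it is may depend on `y`. -/
theorem sum_compensatingShift_sq_le {κ C : ℝ} (hU : ∀ i, ∑ s, U i s ^ 2 ≤ C)
    (hq : ∀ a : Fin n → ℝ, SingleParticipation n κ (fun t => q t (initialSegment a t))
      (fun t => q' t (initialSegment a t))) (y : Fin N → ℝ) :
    ∑ s, compensatingShift L U q q' s y ^ 2 ≤ κ ^ 2 * C := by
  obtain ⟨i, hi, hiκ⟩ := hq (prefixSumAnswer L q' y)
  set a := prefixSumAnswer L q' y with ha
  have h : ∀ s, compensatingShift L U q q' s y =
      (q i (initialSegment a i) - q' i (initialSegment a i)) * U i s := by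
    intro s
    refine Finset.sum_eq_single i (fun j _ hj => ?_) (by simp)
    have hj' : q j (initialSegment a j) = q' j (initialSegment a j) := hi j hj
    rw [← ha, hj', sub_self, zero_mul]
  simp only [h, mul_pow, ← Finset.mul_sum]
  refine mul_le_mul ?_ (hU i) (Finset.sum_nonneg fun s _ => sq_nonneg _) (sq_nonneg _)
  exact sq_le_sq' (by linarith [neg_abs_le (q i (initialSegment a i) - q' i (initialSegment a i))])
    ((le_abs_self _).trans hiκ)

/-- Both views are images under the same map, the answers to `q'`: one of the seed law, the other of
the seed law weighted by the Girsanov density. The moment bound holds for each value of the coins.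
-/
theorem renyiDiv_view_prefixSumMechanism_le {κ C B α : ℝ} (hα : 1 < α)
    (hL : ∀ (t : Fin n) (s : Fin N), t.val < s.val → L t s = 0)
    (hU : ∀ (i : Fin n) (s : Fin N), s.val < i.val → U i s = 0)
    (hLU : ∀ t i : Fin n, i ≤ t → ∑ s, L t s * U i s = 1) (hC : ∀ i, ∑ s, U i s ^ 2 ≤ C)
    (hB : κ ^ 2 * C ≤ 2 * B) (A : StreamAdversary.{u} n)
    {q q' : (t : Fin n) → A.Coins → (Fin t → ℝ) → ℝ}
    (hq : ∀ t : Fin n, Measurable (fun p : A.Coins × (Fin t → ℝ) => q t p.1 p.2))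
    (hq' : ∀ t : Fin n, Measurable (fun p : A.Coins × (Fin t → ℝ) => q' t p.1 p.2))
    (hqq' : ∀ (c : A.Coins) (a : Fin n → ℝ), SingleParticipation n κ
      (fun t => q t c (initialSegment a t)) (fun t => q' t c (initialSegment a t))) :
    renyiDiv α (A.view (prefixSumMechanism L) q) (A.view (prefixSumMechanism L) q') ≤
      ((B * α : ℝ) : EReal) := by
  let γ : Measure (Fin N → ℝ) := Measure.pi fun _ => gaussianReal 0 1
  let m : A.Coins → Fin N → (Fin N → ℝ) → ℝ := fun c =>
    compensatingShift L U (fun t => q t c) (fun t => q' t c)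
  have hview : ∀ {r : (t : Fin n) → A.Coins → (Fin t → ℝ) → ℝ},
      (∀ t : Fin n, Measurable (fun p : A.Coins × (Fin t → ℝ) => r t p.1 p.2)) →
      Measurable (fun p : A.Coins × (Fin N → ℝ) => (p.1, prefixSumAnswer L (fun t => r t p.1) p.2)) :=
    fun hr => A.measurable_view (prefixSumMechanism L) _ hr
  have hm : ∀ s, Measurable fun p : A.Coins × (Fin N → ℝ) => m p.1 s p.2 := by
    intro s
    have hseg : ∀ i, Measurable fun p : A.Coins × (Fin N → ℝ) =>
        (p.1, initialSegment (prefixSumAnswer L (fun t => q' t p.1) p.2) i) := fun i =>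
      measurable_fst.prodMk ((measurable_initialSegment i).comp (hview hq').snd)
    exact Finset.measurable_sum _ fun i _ =>
      (((hq i).comp (hseg i)).sub ((hq' i).comp (hseg i))).mul_const _
  have hmc : ∀ c s, Measurable (m c s) := fun c s => (hm s).comp measurable_prodMk_left
  have hcausal : ∀ c s y y', (∀ r, r < s → y r = y' r) → m c s y = m c s y' := fun c =>
    compensatingShift_congr _ _ hL hU
  let Z : A.Coins × (Fin N → ℝ) → ℝ≥0∞ := fun p =>
    ENNReal.ofReal (Real.exp (∑ s, (m p.1 s p.2 * p.2 s - m p.1 s p.2 ^ 2 / 2)))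
  have hZ : Measurable Z := by
    refine ENNReal.measurable_ofReal.comp (Real.measurable_exp.comp ?_)
    refine Finset.measurable_sum _ fun s _ => ?_
    exact ((hm s).mul ((measurable_pi_apply s).comp measurable_snd)).sub
      (((hm s).pow_const 2).div_const 2)
  have hP : A.view (prefixSumMechanism L) q = ((A.law.prod γ).withDensity Z).map
      (fun p => (p.1, prefixSumAnswer L (fun t => q' t p.1) p.2)) := by
    refine Measure.ext_of_lintegral _ fun F hF => ?_
    have hF' : Measurable fun p : A.Coins × (Fin N → ℝ) =>
        F (p.1, prefixSumAnswer L (fun t => q' t p.1) p.2) := hF.comp (hview hq')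
    have hFq : Measurable fun p : A.Coins × (Fin N → ℝ) =>
        F (p.1, prefixSumAnswer L (fun t => q t p.1) p.2) := hF.comp (hview hq)
    rw [lintegral_map hF (hview hq'), lintegral_withDensity_eq_lintegral_mul _ hZ hF']
    have h1 : ∫⁻ x, F x ∂A.view (prefixSumMechanism L) q = ∫⁻ p, F (p.1, prefixSumAnswer L (fun t => q t p.1) p.2)
        ∂(A.law.prod γ) := lintegral_map hF (hview hq)
    rw [h1, lintegral_prod _ hFq.aemeasurable,
      lintegral_prod _ (hZ.mul hF').aemeasurable]
    refine lintegral_congr fun c => ?_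
    have hFc : Measurable fun y : Fin N → ℝ => F (c, prefixSumAnswer L (fun t => q t c) y) :=
      hFq.comp measurable_prodMk_left
    refine (lintegral_causal_shift (m c) (hmc c) (hcausal c) hFc).symm.trans
      (lintegral_congr fun y => ?_)
    have hs : prefixSumAnswer L (fun t => q t c) (fun s => y s - m c s y) = prefixSumAnswer L (fun t => q' t c) y :=
      prefixSumAnswer_shift _ _ hL hU hLU y
    rw [hs, mul_comm]
    rfl
  have hprob : ∀ {r : (t : Fin n) → A.Coins → (Fin t → ℝ) → ℝ},
      (∀ t : Fin n, Measurable (fun p : A.Coins × (Fin t → ℝ) => r t p.1 p.2)) →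
      IsProbabilityMeasure (A.view (prefixSumMechanism L) r) := fun hr =>
    Measure.isProbabilityMeasure_map (A.measurable_view (prefixSumMechanism L) _ hr).aemeasurable
  have := hprob hq
  have := hprob hq'
  obtain ⟨hac, hle⟩ := lintegral_rnDeriv_rpow_le (ν := A.law.prod γ) (hview hq') hZ
    (Q := A.view (prefixSumMechanism L) q') rfl hP hα
  refine renyiDiv_le_of_lintegral_le hα hac (hle.trans ?_)
  rw [lintegral_prod _ (hZ.pow_const α).aemeasurable]
  calc _ ≤ ∫⁻ _, ENNReal.ofReal (Real.exp (α * (α - 1) * B)) ∂A.law :=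
        lintegral_mono fun c => lintegral_girsanov_rpow_le (m c) (hmc c) (hcausal c)
          (fun y => (sum_compensatingShift_sq_le _ _ hC (hqq' c) y).trans hB) hα
    _ = _ := by simp

end PrefixSum

/-! ### Causal coordinates. -/

open scoped RealInnerProductSpace in
/-- Gram-Schmidt coordinates in which the noise of a prefix-sum mechanism is causal. -/
theorem exists_causal_coordinates {E : Type*} [NormedAddCommGroup E] [InnerProductSpace ℝ E]
    [FiniteDimensional ℝ E] {n N : ℕ} (hN : Module.finrank ℝ E = N) (hn : n ≤ N)
    (l μ : Fin n → E) (h : ∀ t i, ⟪l t, μ i⟫ = if i ≤ t then 1 else 0) :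
    ∃ (b : OrthonormalBasis (Fin N) ℝ E) (U : Fin n → Fin N → ℝ),
      (∀ (t : Fin n) (s : Fin N), t.val < s.val → ⟪l t, b s⟫ = 0) ∧
      (∀ (i : Fin n) (s : Fin N), s.val < i.val → U i s = 0) ∧
      (∀ t i : Fin n, i ≤ t → ∑ s, ⟪l t, b s⟫ * U i s = 1) ∧
      ∀ i, ∑ s, U i s ^ 2 ≤ ‖μ i‖ ^ 2 := by
  -- Zero padding to `N` vectors lets Gram-Schmidt produce a full basis, completed by filler vectors
  -- orthogonal to all `l t`.
  let f : Fin N → E := fun s => if hs : s.val < n then l ⟨s, hs⟩ else 0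
  have hf : ∀ t : Fin n, l t = f ⟨t, t.isLt.trans_le hn⟩ := fun t => by simp [f]
  have hcard : Module.finrank ℝ E = Fintype.card (Fin N) := by simp [hN]
  let b := InnerProductSpace.gramSchmidtOrthonormalBasis hcard f
  have hb : ∀ s, (∀ t, ⟪l t, b s⟫ = 0) ∨ ∀ i : Fin n, s.val < i.val → ⟪b s, μ i⟫ = 0 := by
    intro s
    by_cases hs : InnerProductSpace.gramSchmidtNormed ℝ f s = 0
    · left
      intro t
      rw [real_inner_comm, hf]
      exact InnerProductSpace.inner_gramSchmidtOrthonormalBasis_eq_zero hcard hs _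
    · right
      intro i hi
      have hmem : b s ∈ Submodule.span ℝ (f '' Set.Iic s) := by
        rw [InnerProductSpace.gramSchmidtOrthonormalBasis_apply hcard hs]
        exact Submodule.smul_mem _ _ (InnerProductSpace.gramSchmidt_mem_span ℝ f le_rfl)
      have hle : Submodule.span ℝ (f '' Set.Iic s) ≤ (Submodule.span ℝ {μ i})ᗮ := by
        rw [Submodule.span_le]
        rintro _ ⟨r, hr, rfl⟩
        have hr' : r.val ≤ s.val := Fin.le_def.1 hr
        have hrn : r.val < n := by omega
        rw [SetLike.mem_coe, Submodule.mem_orthogonal_singleton_iff_inner_left]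
        simp only [f, dif_pos hrn, h]
        rw [if_neg]
        rw [Fin.le_def]
        simp only
        omega
      exact Submodule.mem_orthogonal_singleton_iff_inner_left.1 (hle hmem)
  -- Cutting off the coordinates `s < i` makes `U` triangular by construction. By `hb` it does not
  -- affect the pairing with any `l t`, and it can only decrease the norm.
  refine ⟨b, fun i s => if s.val < i.val then 0 else ⟪b s, μ i⟫, ?_, ?_, ?_, ?_⟩
  · intro t s hts
    rw [real_inner_comm, hf]
    exact InnerProductSpace.gramSchmidtOrthonormalBasis_inv_triangular hcard f
      (Fin.lt_def.2 hts)
  · intro i s hs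
    simp [hs]
  · intro t i hit
    rw [← if_pos (c := i ≤ t) (t := (1 : ℝ)) (e := 0) hit, ← h t i,
      ← b.sum_inner_mul_inner (l t) (μ i)]
    refine Finset.sum_congr rfl fun s _ => ?_
    dsimp only
    split_ifs with hs
    · rcases hb s with h0 | h0
      · rw [h0, zero_mul, zero_mul]
      · rw [h0 i hs]
    · rfl
  · intro i
    rw [← b.sum_sq_inner_right (μ i)]
    refine Finset.sum_le_sum fun s _ => ?_
    dsimp only
    split_ifs
    · simpa using sq_nonneg _
    · rfl

/-! ### The Fourier factorization of the prefix-sum matrix. -/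

section FFT

open scoped RealInnerProductSpace ComplexConjugate

/-- The inclusion of the time steps into the indices of the circulant extension. -/
def fftIndex {n : ℕ} (t : Fin n) : Fin (2 * n) := ⟨t, by omega⟩

/-- The primitive root of unity underlying the DFT in dimension `2n`. -/
noncomputable def fftRoot (n : ℕ) : ℂ := Complex.exp (2 * Real.pi * Complex.I / (2 * n : ℕ))

variable {n : ℕ}

theorem isPrimitiveRoot_fftRoot (hn : 0 < n) : IsPrimitiveRoot (fftRoot n) (2 * n) :=
  Complex.isPrimitiveRoot_exp _ (by omega)

theorem norm_fftRoot (hn : 0 < n) : ‖fftRoot n‖ = 1 :=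
  (isPrimitiveRoot_fftRoot hn).norm'_eq_one (by omega)

theorem exp_eq_fftRoot_pow (n k a : ℕ) :
    Complex.exp (-(Complex.I * 2 * Real.pi * k * a) / (2 * n)) = (fftRoot n ^ (k * a))⁻¹ := by
  rw [fftRoot, ← Complex.exp_nat_mul, ← Complex.exp_neg]
  congr 1
  push_cast
  ring

/-- Orthogonality of characters, by summing a geometric series. -/
theorem sum_fftRoot_pow (hn : 0 < n) (t j : ℕ) :
    ∑ k : Fin (2 * n), fftRoot n ^ (k.val * t) * (fftRoot n ^ (k.val * j))⁻¹ =
      if t ≡ j [MOD 2 * n] then ((2 * n : ℕ) : ℂ) else 0 := by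
  have hζ := isPrimitiveRoot_fftRoot hn
  have h0 : fftRoot n ≠ 0 := Complex.exp_ne_zero _
  have hpow : ∀ k : ℕ, fftRoot n ^ (k * t) * (fftRoot n ^ (k * j))⁻¹ =
      (fftRoot n ^ t / fftRoot n ^ j) ^ k := by
    intro k
    rw [div_pow, div_eq_mul_inv, ← pow_mul, ← pow_mul, mul_comm k t, mul_comm k j]
  simp only [hpow]
  rw [Fin.sum_univ_eq_sum_range fun k => (fftRoot n ^ t / fftRoot n ^ j) ^ k]
  have hiff : fftRoot n ^ t / fftRoot n ^ j = 1 ↔ t ≡ j [MOD 2 * n] := by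
    rw [div_eq_one_iff_eq (pow_ne_zero _ h0), (hζ.isOfFinOrder (by omega)).pow_inj_mod,
      ← hζ.eq_orderOf]
    rfl
  split_ifs with h
  · rw [hiff.2 h]
    simp
  · have h1 : fftRoot n ^ t / fftRoot n ^ j ≠ 1 := fun h' => h (hiff.1 h')
    rw [geom_sum_eq h1, div_pow, ← pow_mul, ← pow_mul, mul_comm t, mul_comm j,
      pow_mul _ (2 * n) t, pow_mul _ (2 * n) j, hζ.pow_eq_one]
    simp

theorem fftMatrix_apply (k a : Fin (2 * n)) :
    fftMatrix n k a = ((1 / Real.sqrt (2 * n) : ℝ) : ℂ) * (fftRoot n ^ (k.val * a.val))⁻¹ := by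
  rw [fftMatrix, Matrix.of_apply, exp_eq_fftRoot_pow]

theorem norm_fftMatrix_sq (hn : 0 < n) (k a : Fin (2 * n)) :
    ‖fftMatrix n k a‖ ^ 2 = 1 / (2 * n) := by
  rw [fftMatrix_apply, norm_mul, norm_inv, norm_pow, norm_fftRoot hn, one_pow, inv_one, mul_one,
    Complex.norm_real, Real.norm_eq_abs, sq_abs, div_pow, one_pow, Real.sq_sqrt (by positivity)]

theorem conj_fftMatrix (hn : 0 < n) (k a : Fin (2 * n)) :
    conj (fftMatrix n k a) =
      ((1 / Real.sqrt (2 * n) : ℝ) : ℂ) * fftRoot n ^ (k.val * a.val) := by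
  rw [fftMatrix_apply, map_mul, Complex.conj_ofReal, ← Complex.inv_eq_conj, inv_inv]
  rw [norm_inv, norm_pow, norm_fftRoot hn, one_pow, inv_one]

/-- The circulant matrix with first column `v` extends the prefix-sum matrix. -/
theorem sum_conj_fftMatrix_mul_fftVDFT_mul (hn : 0 < n) (t i : Fin n) :
    ∑ k, conj (fftMatrix n k (fftIndex t)) * fftVDFT n k * fftMatrix n k (fftIndex i) =
      if i ≤ t then 1 else 0 := by
  have hc : (((1 / Real.sqrt (2 * n) : ℝ) : ℂ)) * ((1 / Real.sqrt (2 * n) : ℝ) : ℂ) *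
      ((2 * n : ℕ) : ℂ) = 1 := by
    have hn' : (0 : ℝ) < 2 * n := by positivity
    have : (1 / Real.sqrt (2 * n)) * (1 / Real.sqrt (2 * n)) * ((2 * n : ℕ) : ℝ) = 1 := by
      rw [div_mul_div_comm, one_mul, Real.mul_self_sqrt hn'.le]
      push_cast
      field_simp
    exact_mod_cast this
  set c : ℂ := ((1 / Real.sqrt (2 * n) : ℝ) : ℂ) with hcdef
  have hterm : ∀ k : Fin (2 * n),
      conj (fftMatrix n k (fftIndex t)) * fftVDFT n k * fftMatrix n k (fftIndex i) =
      ∑ a : Fin (2 * n), fftV n a * (c * c * (fftRoot n ^ (k.val * t.val) *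
        (fftRoot n ^ (k.val * (i.val + a.val)))⁻¹)) := by
    intro k
    rw [conj_fftMatrix hn, fftMatrix_apply, fftVDFT, Finset.mul_sum, Finset.sum_mul]
    refine Finset.sum_congr rfl fun a _ => ?_
    rw [exp_eq_fftRoot_pow, mul_add, pow_add, mul_inv]
    simp only [fftIndex]
    ring
  simp only [hterm]
  rw [Finset.sum_comm]
  simp only [← Finset.mul_sum, sum_fftRoot_pow hn]
  have ha : ∀ a : Fin (2 * n), fftV n a * (c * c *
      if t.val ≡ i.val + a.val [MOD 2 * n] then ((2 * n : ℕ) : ℂ) else 0) =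
      if i.val + a.val = t.val then 1 else 0 := by
    intro a
    have hi := i.isLt
    have ht := t.isLt
    by_cases hv : a.val < n
    -- Here `t`, `i` and `a` are below `n`, so `i + a < 2n` and there is no wraparound: this is what
    -- doubling the dimension buys.
    · have hmod : t.val ≡ i.val + a.val [MOD 2 * n] ↔ i.val + a.val = t.val := by
        rw [Nat.ModEq, Nat.mod_eq_of_lt (by omega), Nat.mod_eq_of_lt (by omega), eq_comm]
      simp only [fftV, hv, if_true, one_mul, hmod]
      split_ifs
      · exact hc
      · rw [mul_zero]
    · rw [if_neg (c := i.val + a.val = t.val) (by omega)]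
      simp [fftV, hv]
  simp only [ha]
  split_ifs with hit
  · have hit' := Fin.le_def.1 hit
    have ht := t.isLt
    rw [Finset.sum_eq_single ⟨t.val - i.val, by omega⟩]
    · rw [if_pos]
      simp only
      omega
    · intro a _ h
      rw [if_neg]
      intro h'
      exact h (Fin.ext (by simp only; omega))
    · simp
  · have hit' := Fin.lt_def.1 (not_le.1 hit)
    exact Finset.sum_eq_zero fun a _ => if_neg (by omega)

/-- Otherwise the diagonal entry `1` of the circulant matrix would vanish. This keeps `σ` nonzero
when `κ > 0`. -/
theorem sum_norm_fftVDFT_pos (hn : 0 < n) : 0 < ∑ k, ‖fftVDFT n k‖ := by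
  refine (Finset.sum_nonneg fun k _ => norm_nonneg _).lt_of_ne fun h => ?_
  have h0 : ∀ k, fftVDFT n k = 0 := fun k => norm_eq_zero.1
    ((Finset.sum_eq_zero_iff_of_nonneg fun k _ => norm_nonneg _).1 h.symm k (Finset.mem_univ k))
  simpa [h0] using sum_conj_fftMatrix_mul_fftVDFT_mul hn ⟨0, hn⟩ ⟨0, hn⟩

/-- The diagonal entries of `Σ^{1/2}`. -/
noncomputable def fftSqrtEntry (n : ℕ) (k : Fin (2 * n)) : ℂ := (fftVDFT n k) ^ (1 / 2 : ℂ)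

theorem fftSqrtEntry_mul_self (k : Fin (2 * n)) :
    fftSqrtEntry n k * fftSqrtEntry n k = fftVDFT n k := by
  rw [← pow_two, fftSqrtEntry, one_div]
  exact Complex.cpow_nat_inv_pow (fftVDFT n k) two_ne_zero

theorem norm_fftSqrtEntry_sq (k : Fin (2 * n)) : ‖fftSqrtEntry n k‖ ^ 2 = ‖fftVDFT n k‖ := by
  rw [pow_two, ← norm_mul, fftSqrtEntry_mul_self]

/-- The vector representing the noise coordinate `Re z_t` as a function of `w`. -/
noncomputable def fftNoiseVector (n : ℕ) (σ : ℝ) (t : Fin n) : PiLp 2 fun _ : Fin (2 * n) => ℂ :=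
  WithLp.toLp 2 fun k => conj (σ * (conj (fftMatrix n k (fftIndex t)) * fftSqrtEntry n k))

/-- The shift of `w` that increases the stream entry `x_i` by one. -/
noncomputable def fftShiftVector (n : ℕ) (σ : ℝ) (i : Fin n) : PiLp 2 fun _ : Fin (2 * n) => ℂ :=
  WithLp.toLp 2 fun k => (σ : ℂ)⁻¹ * (fftSqrtEntry n k * fftMatrix n k (fftIndex i))

theorem re_fftNoise (κ ρ : ℝ) (w : PiLp 2 fun _ : Fin (2 * n) => ℂ) (t : Fin n) :
    (fftNoise n κ ρ w.ofLp (fftIndex t)).re = ⟪fftNoiseVector n (fftSigma n κ ρ) t, w⟫ := by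
  rw [PiLp.inner_apply, fftNoise, Pi.smul_apply, fftSqrtSigma, Matrix.mulVec, dotProduct,
    smul_eq_mul, Finset.mul_sum, Complex.re_sum]
  refine Finset.sum_congr rfl fun k _ => ?_
  -- The real inner product on `ℂ` is `Re (conj u * w)`, which undoes the conjugation in
  -- `fftNoiseVector`.
  rw [Matrix.mulVec_diagonal, Complex.inner, fftNoiseVector, Complex.conj_conj,
    Matrix.conjTranspose_apply, fftSqrtEntry]
  congr 1
  simp only [RCLike.star_def]
  ring

theorem inner_fftNoiseVector_fftShiftVector (hn : 0 < n) {σ : ℝ} (hσ : σ ≠ 0) (t i : Fin n) :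
    ⟪fftNoiseVector n σ t, fftShiftVector n σ i⟫ = if i ≤ t then 1 else 0 := by
  have h := congrArg Complex.re (sum_conj_fftMatrix_mul_fftVDFT_mul hn t i)
  rw [Complex.re_sum] at h
  have hre : (if i ≤ t then (1 : ℂ) else 0).re = if i ≤ t then (1 : ℝ) else 0 := by
    split_ifs <;> simp
  rw [← hre, ← h, PiLp.inner_apply]
  refine Finset.sum_congr rfl fun k _ => ?_
  have hσ' : (σ : ℂ) ≠ 0 := by exact_mod_cast hσ
  rw [Complex.inner, fftNoiseVector, fftShiftVector, Complex.conj_conj, ← fftSqrtEntry_mul_self]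
  congr 1
  field_simp

/-- All DFT entries have the same modulus, so the cost of a unit change is the same at every step.
-/
theorem norm_fftShiftVector_sq (hn : 0 < n) (σ : ℝ) (i : Fin n) :
    ‖fftShiftVector n σ i‖ ^ 2 = (∑ k, ‖fftVDFT n k‖) / (2 * n * σ ^ 2) := by
  rw [PiLp.norm_sq_eq_of_L2, Finset.sum_div]
  refine Finset.sum_congr rfl fun k _ => ?_
  rw [fftShiftVector, norm_mul, norm_mul, mul_pow, mul_pow, norm_fftSqrtEntry_sq,
    norm_fftMatrix_sq hn, norm_inv, Complex.norm_real, Real.norm_eq_abs, inv_pow, sq_abs]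
  rw [div_eq_mul_inv (‖fftVDFT n k‖), mul_inv]
  ring

theorem sq_fftSigma (n : ℕ) {κ ρ : ℝ} (hρ : 0 < ρ) :
    fftSigma n κ ρ ^ 2 = κ ^ 2 * (∑ k, ‖fftVDFT n k‖) / (4 * n * ρ) :=
  Real.sq_sqrt (by positivity)

/-- Rotation invariance: the coordinates in any real orthonormal basis are independent standard
normals. -/
theorem fftMechanism_law_eq_map {N : ℕ} (κ ρ : ℝ)
    (b : OrthonormalBasis (Fin N) ℝ (PiLp 2 fun _ : Fin (2 * n) => ℂ)) :
    (fftMechanism n κ ρ).law = (Measure.pi fun _ : Fin N => gaussianReal 0 1).map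
      fun y => (∑ s, y s • b s).ofLp := by
  have h := map_pi_stdComplexNormal (2 * n)
  rw [stdGaussian_eq_map_pi_orthonormalBasis b] at h
  have hof : Measurable (WithLp.ofLp : (PiLp 2 fun _ : Fin (2 * n) => ℂ) → Fin (2 * n) → ℂ) :=
    WithLp.measurable_ofLp _ _
  have h' := congrArg (Measure.map WithLp.ofLp) h
  rw [Measure.map_map hof (WithLp.measurable_toLp _ _), Measure.map_map hof (by fun_prop)] at h'
  have hid : (WithLp.ofLp ∘ WithLp.toLp 2 : (Fin (2 * n) → ℂ) → _) = id := rfl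
  rw [hid, Measure.map_id] at h'
  exact h'

theorem renyiDiv_view_fftMechanism_le (hn : 0 < n) {κ ρ α : ℝ} (hκ : 0 < κ) (hρ : 0 < ρ)
    (hα : 1 < α) (A : StreamAdversary.{u} n)
    {q q' : (t : Fin n) → A.Coins → (Fin t → ℝ) → ℝ}
    (hq : ∀ t : Fin n, Measurable (fun p : A.Coins × (Fin t → ℝ) => q t p.1 p.2))
    (hq' : ∀ t : Fin n, Measurable (fun p : A.Coins × (Fin t → ℝ) => q' t p.1 p.2))
    (hqq' : ∀ (c : A.Coins) (a : Fin n → ℝ), SingleParticipation n κ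
      (fun t => q t c (initialSegment a t)) (fun t => q' t c (initialSegment a t))) :
    renyiDiv α (A.view (fftMechanism n κ ρ) q) (A.view (fftMechanism n κ ρ) q') ≤
      ((ρ * α : ℝ) : EReal) := by
  have hd := sum_norm_fftVDFT_pos hn
  have hn' : (0 : ℝ) < n := by exact_mod_cast hn
  have hσ2 := sq_fftSigma n (κ := κ) hρ
  have hσ : fftSigma n κ ρ ≠ 0 := by
    intro h
    rw [h, zero_pow two_ne_zero] at hσ2
    exact (by positivity : κ ^ 2 * (∑ k, ‖fftVDFT n k‖) / (4 * n * ρ) ≠ 0) hσ2.symm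
  have hfin : n ≤ Module.finrank ℝ (PiLp 2 fun _ : Fin (2 * n) => ℂ) := by
    rw [(WithLp.linearEquiv 2 ℝ (Fin (2 * n) → ℂ)).finrank_eq, Module.finrank_pi_fintype]
    simp
    omega
  obtain ⟨b, U, hL, hU, hLU, hC⟩ := exists_causal_coordinates rfl hfin
    (fftNoiseVector n (fftSigma n κ ρ)) (fftShiftVector n (fftSigma n κ ρ))
    (inner_fftNoiseVector_fftShiftVector hn hσ)
  set L : Fin n → Fin _ → ℝ := fun t s => ⟪fftNoiseVector n (fftSigma n κ ρ) t, b s⟫ with hLdef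
  have hview : ∀ {r : (t : Fin n) → A.Coins → (Fin t → ℝ) → ℝ},
      (∀ t : Fin n, Measurable (fun p : A.Coins × (Fin t → ℝ) => r t p.1 p.2)) →
      A.view (fftMechanism n κ ρ) r = A.view (prefixSumMechanism L) r := by
    intro r hr
    refine A.view_congr_seed (M := fftMechanism n κ ρ) (M' := prefixSumMechanism L)
      (ψ := fun y : Fin _ → ℝ => (∑ s, y s • b s).ofLp) ?_ (fftMechanism_law_eq_map κ ρ b) ?_ hr
    · exact (WithLp.measurable_ofLp _ _).comp
        (by fun_prop : Measurable fun y : Fin _ → ℝ => ∑ s, y s • b s)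
    · intro t x y
      have := re_fftNoise κ ρ (∑ s, (y : Fin _ → ℝ) s • b s) t
      simp only [inner_sum, real_inner_smul_right] at this
      change (∑ s, x s) + _ = (∑ s, x s) + _
      refine congrArg _ (this.trans ?_)
      exact Finset.sum_congr rfl fun s _ => mul_comm _ _
  rw [hview hq, hview hq']
  refine renyiDiv_view_prefixSumMechanism_le hα hL hU hLU
    (fun i => (hC i).trans (norm_fftShiftVector_sq hn _ i).le) (le_of_eq ?_) A hq hq' hqq'
  -- The value of `σ²` is the one for which `κ² ‖v^DFT‖₁ / (2nσ²)` equals `2ρ`.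
  rw [hσ2]
  field_simp
  ring

end FFT

/-! ### Symmetry, the degenerate case and the conclusion. -/

theorem SingleParticipation.symm {n : ℕ} {κ : ℝ} {x y : Fin n → ℝ}
    (h : SingleParticipation n κ x y) : SingleParticipation n κ y x := by
  obtain ⟨i, hi, hκ⟩ := h
  exact ⟨i, fun j hj => (hi j hj).symm, by rwa [abs_sub_comm]⟩

theorem SingleParticipation.eq_of_zero {n : ℕ} {x y : Fin n → ℝ}
    (h : SingleParticipation n 0 x y) : x = y := by
  obtain ⟨i, hi, hκ⟩ := h
  funext j
  by_cases hj : j = i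
  · rw [hj]
    exact sub_eq_zero.1 (abs_nonpos_iff.1 hκ)
  · exact hi j hj

theorem renyiDiv_self_le {X : Type*} [MeasurableSpace X] (P : Measure X) [IsProbabilityMeasure P]
    {α B : ℝ} (hα : 1 < α) (hB : 0 ≤ B) : renyiDiv α P P ≤ ((B * α : ℝ) : EReal) := by
  obtain ⟨hac, hle⟩ := lintegral_rnDeriv_rpow_le (ν := P) (P := P) (Q := P) measurable_id
    (Z := 1) measurable_const (by simp) (by simp) hα
  refine renyiDiv_le_of_lintegral_le hα hac (hle.trans ?_)
  have : 0 ≤ α * (α - 1) * B :=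
    mul_nonneg (mul_nonneg (by linarith) (by linarith)) hB
  simpa using this

theorem mainTheorem8 (n : ℕ) (hn : 0 < n) (κ ρ : ℝ) (hκ : 0 ≤ κ) (hρ : 0 < ρ) :
    (fftMechanism n κ ρ).IsAdaptiveZCDP.{u} (SingleParticipation n κ) ρ := by
  intro A hA α hα
  -- For `κ = 0` the noise vanishes and the shift argument is unavailable, but the two games
  -- coincide. Validity speaks of full transcripts, so a partial one is padded with irrelevant
  -- zeros.
  rcases hκ.eq_or_lt with rfl | hκ
  · have heq : A.left = A.right := by
      funext t c a
      have h := congrFun (hA c fun s => if hs : s.val < t.val then a ⟨s, hs⟩ else 0).eq_of_zero t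
      simpa using h
    have : IsProbabilityMeasure (A.view (fftMechanism n 0 ρ) A.right) :=
      Measure.isProbabilityMeasure_map (A.measurable_view _ _ A.measurable_right).aemeasurable
    rw [heq]
    exact ⟨renyiDiv_self_le _ hα hρ.le, renyiDiv_self_le _ hα hρ.le⟩
  · exact ⟨renyiDiv_view_fftMechanism_le hn hκ hρ hα A A.measurable_left A.measurable_right hA,
      renyiDiv_view_fftMechanism_le hn hκ hρ hα A A.measurable_right A.measurable_left
        fun c a => (hA c a).symm⟩
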